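/- Let $X,Y$ be random variables defined on a common probability space, with values in arbitrary measurable spaces $\mathcal X,\mathcal Y$ and joint distribution $P_{XY}$. The wringing dependence of $X$ and $Y$ is \[ \Delta(X;Y)=\inf_{Q_X,Q_Y}\ \sup_{\mathcal A\subset\mathcal X,\ \mathcal B\subset\mathcal Y}\ \inf\bigl\{\delta\ge 0:\ P_{XY}(\mathcal A\times\mathcal B)^{1+\delta}\le Q_X(\mathcal A)\,Q_Y(\mathcal B)\bigr\}, \] where $Q_X,Q_Y$ range over all probability measures on $\mathcal X,\mathcal Y$, the sets $\mathcal A,\mathcal B$ range over the measurable sets, and $\inf\emptyset=\infty$. For a real random variable $Z$ write $\|Z\|_r=(\mathbb E|Z|^r)^{1/r}$, with the usual limiting conventions at $r\in\{0,\pm\infty\}$. The hypercontractivity ribbon $\mathcal R_{X;Y}$ is the set of pairs $(r,s)$ of extended real numbers such that one of the following holds: \begin{itemize} \item $1\le s\le r$ and $\|\mathbb E[g(Y)\mid X]\|_r\le\|g(Y)\|_s$ for all measurable $g:\mathcal Y\to\mathbb R$ with $g(Y)$ integrable; \item $1\ge s\ge r$ and $\|\mathbb E[g(Y)\mid X]\|_r\ge\|g(Y)\|_s$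 for all measurable $g:\mathcal Y\to[0,\infty)$ with $g(Y)$ integrable. \end{itemize} Let \[ \Delta_{\mathrm{hyp}}(X;Y)=\inf\{\delta\in[0,1]:\ (1+1/\delta,\,1+\delta)\in\mathcal R_{X;Y}\}, \] where $1/0=\infty$. Then \[ \Delta(X;Y)\le\Delta_{\mathrm{hyp}}(X;Y). \] Moreover, for each $n$ let $X^n=(X_1,\dots,X_n)$ and $Y^n=(Y_1,\dots,Y_n)$ be such that the pairs $(X_t,Y_t)$, $t=1,\dots,n$, are i.i.d. with distribution $P_{XY}$. Then $\Delta(X^n;Y^n)$ is non-decreasing in $n$ and \[ \lim_{n\to\infty}\Delta(X^n;Y^n)=\Delta_{\mathrm{hyp}}(X;Y). \] -/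

import Mathlib

open MeasureTheory ProbabilityTheory Filter Topology
open scoped ENNReal NNReal

namespace Wringing

noncomputable section

variable {Ω 𝒳 𝒴 : Type*} [MeasurableSpace Ω] [MeasurableSpace 𝒳] [MeasurableSpace 𝒴]

/-- The wringing dependence
`Δ(X;Y) = inf_{Q_X,Q_Y} sup_{A,B} inf {δ ≥ 0 : P_{XY}(A,B)^(1+δ) ≤ Q_X(A) Q_Y(B)}`,
with values in `[0, ∞]`, so that an infimum over no `δ` is `∞`. The infimum runs over all
probability measures and the supremum over all measurable sets. -/
def wringingDependence (X : Ω → 𝒳) (Y : Ω → 𝒴) (μ : Measure Ω) : ℝ≥0∞ :=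
  ⨅ (QX : ProbabilityMeasure 𝒳) (QY : ProbabilityMeasure 𝒴),
    ⨆ (A : Set 𝒳) (_ : MeasurableSet A) (B : Set 𝒴) (_ : MeasurableSet B),
      ⨅ (δ : ℝ≥0)
        (_ : μ (X ⁻¹' A ∩ Y ⁻¹' B) ^ (1 + (δ : ℝ)) ≤ (QX : Measure 𝒳) A * (QY : Measure 𝒴) B),
        (δ : ℝ≥0∞)

/-- `‖Z‖_r = (E |Z|^r)^(1/r)` for an exponent `r ∈ [-∞, ∞]`, with the usual limiting conventions
at the three exponents where the formula has no direct meaning: the essential supremum at `∞`, the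
essential infimum at `-∞`, and the limit as `p ↓ 0` at `0` (for a probability measure `‖Z‖_p` is
monotone in `p`, so this limit is an infimum). -/
def momentNorm (Z : Ω → ℝ) (r : EReal) (μ : Measure Ω) : ℝ≥0∞ :=
  if r = ⊤ then essSup (fun ω => ‖Z ω‖ₑ) μ
  else if r = ⊥ then essInf (fun ω => ‖Z ω‖ₑ) μ
  else if r = 0 then ⨅ (p : ℝ) (_ : 0 < p), (∫⁻ ω, ‖Z ω‖ₑ ^ p ∂μ) ^ (1 / p)
  else (∫⁻ ω, ‖Z ω‖ₑ ^ r.toReal ∂μ) ^ (1 / r.toReal)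

/-- The conditional expectation `E[g(Y) | X]`. -/
def condExpGiven (X : Ω → 𝒳) (Y : Ω → 𝒴) (μ : Measure Ω) (g : 𝒴 → ℝ) : Ω → ℝ :=
  μ[fun ω => g (Y ω) | MeasurableSpace.comap X inferInstance]

/-- The hypercontractivity ribbon `R_{X;Y}`: the pairs `(r, s)` for which hypercontractivity
(`1 ≤ s ≤ r`) or reverse hypercontractivity (`r ≤ s ≤ 1`) holds. The functions `g` range over the
measurable functions for which `E[g(Y) | X]` is defined. -/
def ribbon (X : Ω → 𝒳) (Y : Ω → 𝒴) (μ : Measure Ω) : Set (EReal × EReal) :=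
  {rs | (1 ≤ rs.2 ∧ rs.2 ≤ rs.1 ∧
      ∀ g : 𝒴 → ℝ, Measurable g → Integrable (fun ω => g (Y ω)) μ →
        momentNorm (condExpGiven X Y μ g) rs.1 μ ≤ momentNorm (fun ω => g (Y ω)) rs.2 μ) ∨
    (rs.2 ≤ 1 ∧ rs.1 ≤ rs.2 ∧
      ∀ g : 𝒴 → ℝ, Measurable g → (∀ y, 0 ≤ g y) → Integrable (fun ω => g (Y ω)) μ →
        momentNorm (fun ω => g (Y ω)) rs.2 μ ≤ momentNorm (condExpGiven X Y μ g) rs.1 μ)}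

/-- `Δ_hyp(X;Y) = inf {δ ∈ [0,1] : (1 + 1/δ, 1 + δ) ∈ R_{X;Y}}`. The exponent `1 + 1/δ` is formed
in `[0, ∞]`, so that it is `∞` at `δ = 0`. -/
def hypDependence (X : Ω → 𝒳) (Y : Ω → 𝒴) (μ : Measure Ω) : ℝ≥0∞ :=
  ⨅ (δ : ℝ≥0) (_ : δ ≤ 1)
    (_ : (((1 + 1 / (δ : ℝ≥0∞) : ℝ≥0∞) : EReal), ((1 + (δ : ℝ≥0∞) : ℝ≥0∞) : EReal))
      ∈ ribbon X Y μ),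
    (δ : ℝ≥0∞)

end

end Wringing

/-! Since `1 + 1/δ` and `1 + δ` are conjugate exponents, duality turns membership of `(1 + 1/δ, 1 +
δ)` in the ribbon into the symmetric bound `E[f(X) g(Y)] ≤ ‖f(X)‖_p ‖g(Y)‖_p` with `p = 1 + δ`
(`BilinearBound`). This bound tensorizes, and on indicators it says that the marginals themselves
are admissible reference measures. Hence the wringing dependence of every i.i.d. power is at most
`Δ_hyp`.

Conversely, let `δ` exceed the wringing dependence of all powers. A vector of length `m * k`
consists of `m` i.i.d. blocks of length `k`. As `m → ∞`, a counting argument replaces the unknown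
reference measures by the marginals of one block (`dominatedBy_map_of_pi`). Thus the set inequality
holds with marginals for every `k`. Applied to level sets of `k`-fold products of simple functions,
it gives the bilinear bound for `k`-th powers up to a factor polynomial in `k`, which vanishes after
taking `k`-th roots (`bilinearBound_of_dominatedBy_pi`). So `Δ_hyp ≤ δ`. -/

namespace Wringing

/-! ### From the ribbon to the bilinear bound. -/

section Bilinear

variable {Ω 𝒳 𝒴 : Type*} [MeasurableSpace Ω] [MeasurableSpace 𝒳] [MeasurableSpace 𝒴]

/-- `E[f(X) g(Y)] ≤ ‖f(X)‖_p ‖g(Y)‖_p` for all nonnegative measurable `f` and `g`. -/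
def BilinearBound (X : Ω → 𝒳) (Y : Ω → 𝒴) (μ : Measure Ω) (p : ℝ) : Prop :=
  ∀ (f : 𝒳 → ℝ≥0∞) (g : 𝒴 → ℝ≥0∞), Measurable f → Measurable g →
    ∫⁻ ω, f (X ω) * g (Y ω) ∂μ ≤
      (∫⁻ ω, f (X ω) ^ p ∂μ) ^ (1 / p) * (∫⁻ ω, g (Y ω) ^ p ∂μ) ^ (1 / p)

/-- It suffices to check the bilinear bound on finite-valued simple functions. -/
theorem BilinearBound.of_simpleFunc {X : Ω → 𝒳} {Y : Ω → 𝒴} {μ : Measure Ω} {p : ℝ}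
    (hX : Measurable X) (hY : Measurable Y) (hp : 0 ≤ p)
    (h : ∀ (f : SimpleFunc 𝒳 ℝ≥0∞) (g : SimpleFunc 𝒴 ℝ≥0∞), (∀ x, f x < ∞) → (∀ y, g y < ∞) →
      ∫⁻ ω, f (X ω) * g (Y ω) ∂μ ≤
        (∫⁻ ω, f (X ω) ^ p ∂μ) ^ (1 / p) * (∫⁻ ω, g (Y ω) ^ p ∂μ) ^ (1 / p)) :
    BilinearBound X Y μ p := by
  intro f g hf hg
  have key : ∀ ω, f (X ω) * g (Y ω) =
      ⨆ n, (SimpleFunc.eapprox f n (X ω) * SimpleFunc.eapprox g n (Y ω)) := by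
    intro ω
    rw [← SimpleFunc.iSup_eapprox_apply hf, ← SimpleFunc.iSup_eapprox_apply hg]
    refine le_antisymm ?_ ENNReal.iSup_mul_le
    simp_rw [ENNReal.iSup_mul, ENNReal.mul_iSup]
    refine iSup_le fun i => iSup_le fun j => le_iSup_of_le (max i j) ?_
    exact mul_le_mul' (SimpleFunc.monotone_eapprox f (le_max_left i j) (X ω))
      (SimpleFunc.monotone_eapprox g (le_max_right i j) (Y ω))
  simp_rw [key]
  rw [lintegral_iSup]
  · refine iSup_le fun n => (h _ _ (SimpleFunc.eapprox_lt_top f n)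
      (SimpleFunc.eapprox_lt_top g n)).trans ?_
    have hfn : ∀ x, SimpleFunc.eapprox f n x ≤ f x := fun x => by
      rw [← SimpleFunc.iSup_eapprox_apply hf x]
      exact le_iSup (fun n => SimpleFunc.eapprox f n x) n
    have hgn : ∀ x, SimpleFunc.eapprox g n x ≤ g x := fun x => by
      rw [← SimpleFunc.iSup_eapprox_apply hg x]
      exact le_iSup (fun n => SimpleFunc.eapprox g n x) n
    have hp' : 0 ≤ 1 / p := by positivity
    gcongr with ω ω
    · exact hfn _
    · exact hgn _
  · intro n
    exact ((SimpleFunc.measurable _).comp hX).mul ((SimpleFunc.measurable _).comp hY)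
  · intro i j hij ω
    exact mul_le_mul' (SimpleFunc.monotone_eapprox f hij (X ω))
      (SimpleFunc.monotone_eapprox g hij (Y ω))

/-- The averaging property of the conditional expectation of a nonnegative function, tested
against nonnegative functions of `X`. -/
theorem lintegral_mul_enorm_condExp {X : Ω → 𝒳} {μ : Measure Ω} [IsProbabilityMeasure μ]
    (hX : Measurable X) {u : Ω → ℝ} (hu : Integrable u μ) (hu' : Measurable u) (h0 : 0 ≤ u)
    {f : 𝒳 → ℝ≥0∞} (hf : Measurable f) :
    ∫⁻ ω, f (X ω) * ‖(μ[u | MeasurableSpace.comap X inferInstance]) ω‖ₑ ∂μ =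
      ∫⁻ ω, f (X ω) * ‖u ω‖ₑ ∂μ := by
  -- The `[0, ∞]`-valued conditional expectation is used because `f` may be unbounded: the densities
  -- `v` and `‖u‖ₑ` then push forward under `X` to the same measure, against which any `f` can be
  -- integrated.
  obtain ⟨v, hvm, hvs, hva⟩ : ∃ v : Ω → ℝ≥0∞, Measurable v ∧
      (∀ s : Set 𝒳, MeasurableSet s → ∫⁻ ω in X ⁻¹' s, v ω ∂μ = ∫⁻ ω in X ⁻¹' s, ‖u ω‖ₑ ∂μ) ∧
      v =ᵐ[μ] fun ω => ‖(μ[u | MeasurableSpace.comap X inferInstance]) ω‖ₑ :=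
    ⟨μ⁻[fun x ↦ ‖u x‖ₑ | MeasurableSpace.comap X inferInstance],
      (measurable_condLExp _ _ _).mono hX.comap_le le_rfl,
      fun s hs => setLIntegral_condLExp hX.comap_le μ _ ⟨s, hs, rfl⟩,
      condLExp_enorm _ hu (ae_of_all _ h0)⟩
  have hmap : (μ.withDensity v).map X = (μ.withDensity (fun x => ‖u x‖ₑ)).map X := by
    ext s hs
    rw [Measure.map_apply hX hs, Measure.map_apply hX hs, withDensity_apply _ (hX hs),
      withDensity_apply _ (hX hs), hvs s hs]
  have h1 : ∫⁻ ω, f (X ω) * ‖(μ[u | MeasurableSpace.comap X inferInstance]) ω‖ₑ ∂μ =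
      ∫⁻ ω, f (X ω) * v ω ∂μ := by
    refine lintegral_congr_ae ?_
    filter_upwards [hva] with ω hω
    rw [hω]
  have h2 : ∀ w : Ω → ℝ≥0∞, Measurable w →
      ∫⁻ ω, f (X ω) * w ω ∂μ = ∫⁻ x, f x ∂((μ.withDensity w).map X) := by
    intro w hw
    rw [lintegral_map hf hX]
    exact ((lintegral_withDensity_eq_lintegral_mul _ hw (hf.comp hX)).trans
      (by simp [mul_comm])).symm
  rw [h1, h2 _ hvm, hmap, ← h2 _ hu'.enorm]

theorem momentNorm_of_one_le {Z : Ω → ℝ} {μ : Measure Ω} {r : ℝ≥0∞} (h1 : 1 ≤ r) (hr : r ≠ ∞) :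
    momentNorm Z (r : EReal) μ = (∫⁻ ω, ‖Z ω‖ₑ ^ r.toReal ∂μ) ^ (1 / r.toReal) := by
  have h0 : r ≠ 0 := (zero_lt_one.trans_le h1).ne'
  unfold momentNorm
  rw [if_neg (by simpa using hr), if_neg (by simp), if_neg (by simpa using h0)]
  simp

/-- Replace `g(Y)` by `E[g(Y) | X]` under the integral against `f(X)`, apply Hölder, then
contractivity. -/
theorem bilinearBound_of_mem_ribbon {X : Ω → 𝒳} {Y : Ω → 𝒴} {μ : Measure Ω}
    [IsProbabilityMeasure μ] (hX : Measurable X) (hY : Measurable Y) {δ : ℝ≥0}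
    (h : (((1 + 1 / (δ : ℝ≥0∞) : ℝ≥0∞) : EReal), ((1 + (δ : ℝ≥0∞) : ℝ≥0∞) : EReal))
      ∈ ribbon X Y μ) :
    BilinearBound X Y μ (1 + δ) := by
  have hcontr : ∀ g : 𝒴 → ℝ, Measurable g → Integrable (fun ω => g (Y ω)) μ →
      momentNorm (condExpGiven X Y μ g) ((1 + 1 / (δ : ℝ≥0∞) : ℝ≥0∞) : EReal) μ ≤
        momentNorm (fun ω => g (Y ω)) ((1 + (δ : ℝ≥0∞) : ℝ≥0∞) : EReal) μ := by
    rcases h with h | ⟨hs, hrs, -⟩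
    · exact h.2.2
    -- The reverse branch would force `1 + 1/δ ≤ 1`, impossible for finite `δ`.
    · exfalso
      have hle := hrs.trans hs
      simp only at hle
      have : (1 + 1 / (δ : ℝ≥0∞) : ℝ≥0∞) ≤ 1 := by exact_mod_cast hle
      have h2 : 1 / (δ : ℝ≥0∞) = 0 := by
        by_contra h2
        exact absurd this (not_le.2 (ENNReal.lt_add_right ENNReal.one_ne_top h2))
      simp at h2
  refine BilinearBound.of_simpleFunc hX hY (by positivity) fun f g hf hg => ?_
  have hgm : Measurable fun y => (g y).toReal := g.measurable.ennreal_toReal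
  have hint : Integrable (fun ω => (g (Y ω)).toReal) μ := by
    obtain ⟨C, hC⟩ := (g.map ENNReal.toReal).exists_forall_norm_le
    exact Integrable.of_bound (hgm.comp hY).aestronglyMeasurable C (ae_of_all _ fun ω => hC (Y ω))
  have hgn : ∀ ω, ‖(g (Y ω)).toReal‖ₑ = g (Y ω) := fun ω => by
    rw [Real.enorm_eq_ofReal ENNReal.toReal_nonneg, ENNReal.ofReal_toReal (hg _).ne]
  have hav := lintegral_mul_enorm_condExp hX hint (hgm.comp hY) (fun _ => ENNReal.toReal_nonneg)
    f.measurable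
  have hcm : Measurable (condExpGiven X Y μ fun y => (g y).toReal) :=
    stronglyMeasurable_condExp.measurable.mono hX.comap_le le_rfl
  simp only [hgn] at hav
  rw [← hav]
  have hs := hcontr _ hgm hint
  rw [momentNorm_of_one_le (r := 1 + (δ : ℝ≥0∞)) le_self_add (by simp)] at hs
  have hδ : (1 + (δ : ℝ≥0∞)).toReal = 1 + (δ : ℝ) := by
    rw [ENNReal.toReal_add (by simp) (by simp)]; simp
  simp only [hδ, hgn] at hs
  refine le_trans ?_ (mul_le_mul_right hs _)
  rcases eq_or_ne δ 0 with rfl | hδ0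
  -- At `δ = 0` Hölder degenerates to the bound by the essential supremum.
  · have hr : ((1 + 1 / ((0 : ℝ≥0) : ℝ≥0∞) : ℝ≥0∞) : EReal) = ⊤ := by simp
    rw [hr, momentNorm, if_pos rfl]
    have hfm : Measurable fun ω => f (X ω) := f.measurable.comp hX
    simp only [NNReal.coe_zero, add_zero, ENNReal.rpow_one, div_one]
    rw [← lintegral_mul_const _ hfm]
    refine lintegral_mono_ae ?_
    filter_upwards [ENNReal.ae_le_essSup
      (fun ω => ‖(condExpGiven X Y μ fun y => (g y).toReal) ω‖ₑ)] with ω hω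
    exact mul_le_mul_right hω _
  · have hpos : (0 : ℝ) < δ := by exact_mod_cast pos_iff_ne_zero.2 hδ0
    have hr : (1 + 1 / (δ : ℝ≥0∞)).toReal = 1 + 1 / (δ : ℝ) := by
      rw [ENNReal.toReal_add (by simp) (by simp [hδ0])]; simp
    rw [momentNorm_of_one_le (r := 1 + 1 / (δ : ℝ≥0∞)) le_self_add (by simp [hδ0]), hr]
    have hpq : (1 + (δ : ℝ)).HolderConjugate (1 + 1 / (δ : ℝ)) := by
      rw [Real.holderConjugate_iff]
      refine ⟨by linarith, ?_⟩
      field_simp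
      ring
    exact ENNReal.lintegral_mul_le_Lp_mul_Lq μ hpq (f.measurable.comp hX).aemeasurable
      hcm.enorm.aemeasurable

end Bilinear

end Wringing

namespace Wringing

/-! ### From the bilinear bound back to the ribbon. -/

section Bilinear

variable {Ω 𝒳 𝒴 : Type*} [MeasurableSpace Ω] [MeasurableSpace 𝒳] [MeasurableSpace 𝒴]

theorem bilinearBound_two (X : Ω → 𝒳) (Y : Ω → 𝒴) (μ : Measure Ω)
    (hX : Measurable X) (hY : Measurable Y) : BilinearBound X Y μ 2 := fun _ _ hf hg =>
  ENNReal.lintegral_mul_le_Lp_mul_Lq μ Real.HolderConjugate.two_two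
    (hf.comp hX).aemeasurable (hg.comp hY).aemeasurable

/-- Cancelling a finite factor `a^(1/p)` from `a ≤ a^(1/p) b`, where `1/p + 1/r = 1`. -/
theorem rpow_le_of_le_rpow_mul {a b : ℝ≥0∞} {p r : ℝ} (hpr : p.HolderConjugate r) (ha : a ≠ ∞)
    (h : a ≤ a ^ (1 / p) * b) : a ^ (1 / r) ≤ b := by
  rcases eq_or_ne a 0 with rfl | h0
  · rw [ENNReal.zero_rpow_of_pos (one_div_pos.2 hpr.symm.pos)]
    exact zero_le
  have hsplit : a = a ^ (1 / p) * a ^ (1 / r) := by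
    rw [← ENNReal.rpow_add _ _ h0 ha, one_div, one_div, hpr.inv_add_inv_eq_one, ENNReal.rpow_one]
  have hne0 : a ^ (1 / p) ≠ 0 := by simp [h0, ha]
  have hnet : a ^ (1 / p) ≠ ∞ := ENNReal.rpow_ne_top_of_nonneg (one_div_pos.2 hpr.pos).le ha
  rw [← ENNReal.mul_le_mul_iff_right hne0 hnet, ← hsplit]
  exact h

/-- Duality: with `t` a truncation of `|E[g(Y) | X]|`, the test function `t^(1/δ)` is extremal in
Hölder, since its `p`-th power and its product with `t` are both `t^r`. Cancelling and removing the
truncation gives the norm inequality. -/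
theorem mem_ribbon_of_bilinearBound {X : Ω → 𝒳} {Y : Ω → 𝒴} {μ : Measure Ω}
    [IsProbabilityMeasure μ] (hX : Measurable X) (hY : Measurable Y) {δ : ℝ≥0}
    (h0 : 0 < δ) (h1 : δ ≤ 1) (h : BilinearBound X Y μ (1 + δ)) :
    (((1 + 1 / (δ : ℝ≥0∞) : ℝ≥0∞) : EReal), ((1 + (δ : ℝ≥0∞) : ℝ≥0∞) : EReal))
      ∈ ribbon X Y μ := by
  have hδ0 : δ ≠ 0 := h0.ne'
  have hpos : (0 : ℝ) < δ := by exact_mod_cast h0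
  refine Or.inl ⟨?_, ?_, fun g hg hint => ?_⟩
  · have : (1 : ℝ≥0∞) ≤ 1 + δ := le_self_add
    exact EReal.coe_ennreal_le_coe_ennreal_iff.2 this
  · have hδ1 : (δ : ℝ≥0∞) ≤ 1 := by exact_mod_cast h1
    have : (1 + (δ : ℝ≥0∞)) ≤ 1 + 1 / (δ : ℝ≥0∞) := by
      gcongr
      exact hδ1.trans (by rw [one_div]; exact ENNReal.one_le_inv.2 hδ1)
    exact EReal.coe_ennreal_le_coe_ennreal_iff.2 this
  have hδ : (1 + (δ : ℝ≥0∞)).toReal = 1 + (δ : ℝ) := by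
    rw [ENNReal.toReal_add (by simp) (by simp)]; simp
  have hr : (1 + 1 / (δ : ℝ≥0∞)).toReal = 1 + 1 / (δ : ℝ) := by
    rw [ENNReal.toReal_add (by simp) (by simp [hδ0])]; simp
  have hpq : (1 + (δ : ℝ)).HolderConjugate (1 + 1 / (δ : ℝ)) := by
    rw [Real.holderConjugate_iff]
    refine ⟨by linarith, ?_⟩
    field_simp
    ring
  simp only
  rw [momentNorm_of_one_le (r := 1 + 1 / (δ : ℝ≥0∞)) le_self_add (by simp [hδ0]),
    momentNorm_of_one_le (r := 1 + (δ : ℝ≥0∞)) le_self_add (by simp), hδ, hr]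
  set p : ℝ := 1 + δ with hp
  set r : ℝ := 1 + 1 / (δ : ℝ) with hrdef
  obtain ⟨φ, hφm, hφ⟩ : ∃ φ : 𝒳 → ℝ, Measurable φ ∧ condExpGiven X Y μ g = φ ∘ X := by
    have hm : Measurable[MeasurableSpace.comap X inferInstance] (condExpGiven X Y μ g) :=
      stronglyMeasurable_condExp.measurable
    exact hm.exists_eq_measurable_comp
  have habs : ∀ᵐ ω ∂μ, ‖φ (X ω)‖ₑ ≤
      ‖(μ[fun ω => |g (Y ω)| | MeasurableSpace.comap X inferInstance]) ω‖ₑ := by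
    filter_upwards [abs_condExp_ae_le_condExp_abs (μ := μ)
      (m := MeasurableSpace.comap X inferInstance) (fun ω => g (Y ω))] with ω hω
    have h2 : condExpGiven X Y μ g ω = φ (X ω) := congrFun hφ ω
    rw [← h2, enorm_le_iff_norm_le, Real.norm_eq_abs]
    exact hω.trans (le_abs_self _)
  have hrpos : 0 < r := hpq.symm.pos
  -- Truncation makes `∫ t^r` finite, so that its power can be cancelled.
  set t : ℕ → 𝒳 → ℝ≥0∞ := fun n x => min ‖φ x‖ₑ n with ht
  have htm : ∀ n, Measurable (t n) := fun n => hφm.enorm.min measurable_const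
  have hbound : ∀ n : ℕ, (∫⁻ ω, t n (X ω) ^ r ∂μ) ^ (1 / r) ≤
      (∫⁻ ω, ‖g (Y ω)‖ₑ ^ p ∂μ) ^ (1 / p) := by
    intro n
    refine rpow_le_of_le_rpow_mul hpq ?_ ?_
    · refine ne_top_of_le_ne_top (b := (n : ℝ≥0∞) ^ r)
        (ENNReal.rpow_ne_top_of_nonneg hrpos.le (by simp)) ?_
      calc ∫⁻ ω, t n (X ω) ^ r ∂μ ≤ ∫⁻ _, (n : ℝ≥0∞) ^ r ∂μ := by
            gcongr
            exact min_le_right _ _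
        _ = (n : ℝ≥0∞) ^ r := by simp
    · have hfm : Measurable fun x => t n x ^ (1 / (δ : ℝ)) := (htm n).pow_const _
      have hexp : (1 / (δ : ℝ)) * p = r := by rw [hp, hrdef]; field_simp; ring
      have hB := h (fun x => t n x ^ (1 / (δ : ℝ))) (fun y => ‖g y‖ₑ) hfm hg.enorm
      simp only [← ENNReal.rpow_mul, hexp] at hB
      refine le_trans ?_ hB
      have hav := lintegral_mul_enorm_condExp hX hint.abs
        (continuous_abs.measurable.comp (hg.comp hY)) (fun _ => abs_nonneg _) hfm
      have habs' : ∀ ω, ‖|g (Y ω)|‖ₑ = ‖g (Y ω)‖ₑ := fun ω => by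
        rw [← Real.norm_eq_abs, enorm_norm]
      simp only [habs'] at hav
      rw [← hav]
      refine lintegral_mono_ae ?_
      filter_upwards [habs] with ω hω
      have hsplit : t n (X ω) ^ r = t n (X ω) ^ (1 / (δ : ℝ)) * t n (X ω) := by
        rw [hrdef, add_comm, ENNReal.rpow_add_of_nonneg _ _ (by positivity) zero_le_one,
          ENNReal.rpow_one]
      rw [hsplit]
      exact mul_le_mul_right ((min_le_left _ _).trans hω) _
  have hsup : ∀ ω, ‖condExpGiven X Y μ g ω‖ₑ ^ r = ⨆ n, t n (X ω) ^ r := by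
    intro ω
    have h2 : condExpGiven X Y μ g ω = φ (X ω) := congrFun hφ ω
    rw [h2]
    refine le_antisymm ?_ (iSup_le fun n => ENNReal.rpow_le_rpow (min_le_left _ _) hrpos.le)
    obtain ⟨n, hn⟩ := ENNReal.exists_nat_gt (enorm_ne_top (x := φ (X ω)))
    exact le_iSup_of_le n (by simp only [ht]; rw [min_eq_left hn.le])
  simp_rw [hsup]
  have htX : ∀ n, Measurable fun ω => t n (X ω) ^ r := fun n => ((htm n).comp hX).pow_const r
  rw [lintegral_iSup htX]
  · rw [one_div, one_div, ENNReal.rpow_inv_le_iff hrpos]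
    refine iSup_le fun n => ?_
    rw [← ENNReal.rpow_inv_le_iff hrpos, ← one_div, ← one_div]
    exact hbound n
  · intro i j hij ω
    refine ENNReal.rpow_le_rpow (min_le_min le_rfl ?_) hrpos.le
    exact_mod_cast hij

end Bilinear

/-! ### Tensorization. -/

section Tensor

variable {Ω 𝒳 𝒴 : Type*} [MeasurableSpace Ω] [MeasurableSpace 𝒳] [MeasurableSpace 𝒴]
variable {Ω' 𝒳' 𝒴' : Type*} [MeasurableSpace Ω'] [MeasurableSpace 𝒳'] [MeasurableSpace 𝒴']

/-- Apply the second bound to the inner integral with the first coordinate fixed, then the first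
bound to the resulting partial `p`-norms of `f` and `g`. -/
theorem BilinearBound.prod {X : Ω → 𝒳} {Y : Ω → 𝒴} {μ : Measure Ω} {X' : Ω' → 𝒳'} {Y' : Ω' → 𝒴'}
    {μ' : Measure Ω'} [SFinite μ] [SFinite μ'] {p : ℝ} (hp : 0 < p)
    (hX : Measurable X) (hY : Measurable Y) (hX' : Measurable X') (hY' : Measurable Y')
    (h : BilinearBound X Y μ p) (h' : BilinearBound X' Y' μ' p) :
    BilinearBound (Prod.map X X') (Prod.map Y Y') (μ.prod μ') p := by
  intro f g hf hg
  have hfm : Measurable fun z : 𝒳 × Ω' => f (z.1, X' z.2) ^ p :=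
    (hf.comp (measurable_fst.prodMk (hX'.comp measurable_snd))).pow_const p
  have hgm : Measurable fun z : 𝒴 × Ω' => g (z.1, Y' z.2) ^ p :=
    (hg.comp (measurable_fst.prodMk (hY'.comp measurable_snd))).pow_const p
  have hfX : Measurable fun z : Ω × Ω' => f (Prod.map X X' z) := hf.comp (hX.prodMap hX')
  have hgY : Measurable fun z : Ω × Ω' => g (Prod.map Y Y' z) := hg.comp (hY.prodMap hY')
  have hfg : Measurable fun z : Ω × Ω' => f (Prod.map X X' z) * g (Prod.map Y Y' z) := hfX.mul hgY
  rw [lintegral_prod _ hfg.aemeasurable,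
    lintegral_prod _ (hfX.pow_const p).aemeasurable,
    lintegral_prod _ (hgY.pow_const p).aemeasurable]
  have hF := (hfm.lintegral_prod_right' (ν := μ')).pow_const (1 / p)
  have hG := (hgm.lintegral_prod_right' (ν := μ')).pow_const (1 / p)
  have hout := h _ _ hF hG
  simp only [← ENNReal.rpow_mul, one_div, inv_mul_cancel₀ hp.ne', ENNReal.rpow_one] at hout
  simp only [one_div, Prod.map_apply]
  refine le_trans (lintegral_mono fun ω => ?_) hout
  have hin := h' (fun x' => f (X ω, x')) (fun y' => g (Y ω, y'))
    (hf.comp measurable_prodMk_left) (hg.comp measurable_prodMk_left)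
  simpa only [one_div] using hin

/-- Transport of the bilinear bound along a measure-preserving map. -/
theorem BilinearBound.of_measurePreserving {X : Ω → 𝒳} {Y : Ω → 𝒴} {μ : Measure Ω}
    {X' : Ω' → 𝒳'} {Y' : Ω' → 𝒴'} {μ' : Measure Ω'} {p : ℝ} (hX : Measurable X) (hY : Measurable Y)
    {T : Ω' → Ω} (hT : MeasurePreserving T μ' μ) {φ : 𝒳 → 𝒳'} {ψ : 𝒴 → 𝒴'} (hφ : Measurable φ)
    (hψ : Measurable ψ) (hφX : ∀ ω, X' ω = φ (X (T ω))) (hψY : ∀ ω, Y' ω = ψ (Y (T ω)))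
    (h : BilinearBound X Y μ p) : BilinearBound X' Y' μ' p := by
  intro f g hf hg
  have hfX : Measurable fun ω => f (φ (X ω)) := hf.comp (hφ.comp hX)
  have hgY : Measurable fun ω => g (ψ (Y ω)) := hg.comp (hψ.comp hY)
  simp only [hφX, hψY]
  have hfg : Measurable fun ω => f (φ (X ω)) * g (ψ (Y ω)) := hfX.mul hgY
  rw [hT.lintegral_comp hfg, hT.lintegral_comp (hfX.pow_const p),
    hT.lintegral_comp (hgY.pow_const p)]
  exact h _ _ (hf.comp hφ) (hg.comp hψ)

/-- Apply `X` to every coordinate. -/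
def coordwise {ι : Type*} (X : Ω → 𝒳) (ω : ι → Ω) : ι → 𝒳 := fun i => X (ω i)

theorem measurable_coordwise {ι : Type*} {X : Ω → 𝒳} (hX : Measurable X) :
    Measurable (coordwise (ι := ι) X) :=
  measurable_pi_lambda _ fun i => hX.comp (measurable_pi_apply i)

theorem measurable_fin_cons {n : ℕ} :
    Measurable fun z : 𝒳 × (Fin n → 𝒳) => (Fin.cons z.1 z.2 : Fin (n + 1) → 𝒳) := by
  refine measurable_pi_lambda _ fun i => ?_
  refine Fin.cases ?_ (fun j => ?_) i
  · exact measurable_fst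
  · exact (measurable_pi_apply j).comp measurable_snd

/-- Tensorization of the bilinear bound. -/
theorem BilinearBound.pi {X : Ω → 𝒳} {Y : Ω → 𝒴} {μ : Measure Ω} [IsProbabilityMeasure μ] {p : ℝ}
    (hp : 0 < p) (hX : Measurable X) (hY : Measurable Y) (h : BilinearBound X Y μ p) (n : ℕ) :
    BilinearBound (coordwise X) (coordwise Y) (Measure.pi fun _ : Fin n => μ) p := by
  induction n with
  | zero =>
    intro f g hf hg
    simp only [Subsingleton.elim (coordwise X _) (Fin.elim0 : Fin 0 → 𝒳),
      Subsingleton.elim (coordwise Y _) (Fin.elim0 : Fin 0 → 𝒴), lintegral_const, measure_univ,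
      mul_one, ← ENNReal.rpow_mul, mul_one_div_cancel hp.ne', ENNReal.rpow_one, le_refl]
  | succ n ih =>
    have hprod := h.prod hp hX hY (measurable_coordwise hX) (measurable_coordwise hY) ih
    refine hprod.of_measurePreserving (hX.prodMap (measurable_coordwise hX)) (hY.prodMap (measurable_coordwise hY))
      (measurePreserving_piFinSuccAbove (fun _ : Fin (n + 1) => μ) 0)
      measurable_fin_cons measurable_fin_cons (fun ω => ?_) (fun ω => ?_)
    · funext i
      refine Fin.cases ?_ (fun j => ?_) i <;>
        simp [coordwise, MeasurableEquiv.piFinSuccAbove, Fin.tail]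
    · funext i
      refine Fin.cases ?_ (fun j => ?_) i <;>
        simp [coordwise, MeasurableEquiv.piFinSuccAbove, Fin.tail]

end Tensor

end Wringing

namespace Wringing

/-! ### The set inequality and data processing. -/

section Sets

variable {Ω 𝒳 𝒴 : Type*} [MeasurableSpace Ω] [MeasurableSpace 𝒳] [MeasurableSpace 𝒴]

/-- The defining inequality of the wringing dependence, for given reference measures. -/
def DominatedBy (X : Ω → 𝒳) (Y : Ω → 𝒴) (μ : Measure Ω) (QX : Measure 𝒳) (QY : Measure 𝒴)
    (δ : ℝ≥0) : Prop :=
  ∀ (A : Set 𝒳) (B : Set 𝒴), MeasurableSet A → MeasurableSet B →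
    μ (X ⁻¹' A ∩ Y ⁻¹' B) ^ (1 + (δ : ℝ)) ≤ QX A * QY B

theorem wringingDependence_le {X : Ω → 𝒳} {Y : Ω → 𝒴} {μ : Measure Ω} {QX : Measure 𝒳}
    {QY : Measure 𝒴} [IsProbabilityMeasure QX] [IsProbabilityMeasure QY] {δ : ℝ≥0}
    (h : DominatedBy X Y μ QX QY δ) : wringingDependence X Y μ ≤ δ := by
  refine iInf₂_le_of_le ⟨QX, ‹_›⟩ ⟨QY, ‹_›⟩ ?_
  refine iSup₂_le fun A hA => iSup₂_le fun B hB => ?_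
  exact iInf₂_le_of_le δ (h A B hA hB) le_rfl

theorem exists_dominatedBy_of_wringingDependence_lt {X : Ω → 𝒳} {Y : Ω → 𝒴} {μ : Measure Ω}
    [IsProbabilityMeasure μ] {δ : ℝ≥0} (h : wringingDependence X Y μ < δ) :
    ∃ (QX : Measure 𝒳) (QY : Measure 𝒴), IsProbabilityMeasure QX ∧ IsProbabilityMeasure QY ∧
      DominatedBy X Y μ QX QY δ := by
  unfold wringingDependence at h
  simp only [iInf_lt_iff] at h
  obtain ⟨QX, QY, h⟩ := h
  refine ⟨QX, QY, inferInstance, inferInstance, fun A B hA hB => ?_⟩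
  have h2 := lt_of_le_of_lt (le_iSup₂_of_le A hA (le_iSup₂_of_le B hB le_rfl)) h
  simp only [iInf_lt_iff] at h2
  obtain ⟨δ', h3, h4⟩ := h2
  -- The witness `δ' < δ` depends on `A` and `B`; as probabilities are at most one, the larger
  -- exponent `1 + δ` serves all pairs.
  refine le_trans (ENNReal.rpow_le_rpow_of_exponent_ge prob_le_one ?_) h3
  have : (δ' : ℝ) < δ := by exact_mod_cast h4
  linarith

/-- Test on indicators, which equal their own `p`-th powers. -/
theorem BilinearBound.dominatedBy {X : Ω → 𝒳} {Y : Ω → 𝒴} {μ : Measure Ω}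
    (hX : Measurable X) (hY : Measurable Y) {δ : ℝ≥0} (h : BilinearBound X Y μ (1 + δ)) :
    DominatedBy X Y μ (μ.map X) (μ.map Y) δ := by
  intro A B hA hB
  have hp : (0 : ℝ) < 1 + δ := by positivity
  have hk := h (A.indicator 1) (B.indicator 1) (measurable_one.indicator hA)
    (measurable_one.indicator hB)
  have hA' : ∀ ω, (A.indicator 1 (X ω) : ℝ≥0∞) ^ (1 + (δ : ℝ)) = (X ⁻¹' A).indicator 1 ω := by
    intro ω
    by_cases hω : X ω ∈ A <;> simp [hω, hp]
  have hB' : ∀ ω, (B.indicator 1 (Y ω) : ℝ≥0∞) ^ (1 + (δ : ℝ)) = (Y ⁻¹' B).indicator 1 ω := by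
    intro ω
    by_cases hω : Y ω ∈ B <;> simp [hω, hp]
  have hAB : ∀ ω, (A.indicator 1 (X ω) : ℝ≥0∞) * B.indicator 1 (Y ω) =
      (X ⁻¹' A ∩ Y ⁻¹' B).indicator 1 ω := by
    intro ω
    by_cases hω : X ω ∈ A <;> by_cases hω' : Y ω ∈ B <;> simp [hω, hω']
  simp only [hA', hB', hAB] at hk
  rw [lintegral_indicator_one ((hX hA).inter (hY hB)), lintegral_indicator_one (hX hA),
    lintegral_indicator_one (hY hB), ← ENNReal.mul_rpow_of_nonneg _ _ (by positivity), one_div,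
    ENNReal.le_rpow_inv_iff hp] at hk
  rwa [Measure.map_apply hX hA, Measure.map_apply hY hB]

variable {Ω' 𝒳' 𝒴' : Type*} [MeasurableSpace Ω'] [MeasurableSpace 𝒳'] [MeasurableSpace 𝒴']

/-- Data processing for the wringing dependence. -/
theorem wringingDependence_le_of_map {X : Ω → 𝒳} {Y : Ω → 𝒴} {μ : Measure Ω}
    {X' : Ω' → 𝒳'} {Y' : Ω' → 𝒴'} {μ' : Measure Ω'} {φ : 𝒳 → 𝒳'} {ψ : 𝒴 → 𝒴'}
    (hφ : Measurable φ) (hψ : Measurable ψ)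
    (h : ∀ (A : Set 𝒳') (B : Set 𝒴'), MeasurableSet A → MeasurableSet B →
      μ' (X' ⁻¹' A ∩ Y' ⁻¹' B) = μ (X ⁻¹' (φ ⁻¹' A) ∩ Y ⁻¹' (ψ ⁻¹' B))) :
    wringingDependence X' Y' μ' ≤ wringingDependence X Y μ := by
  refine le_iInf₂ fun QX QY => ?_
  -- With pushed-forward reference measures, the new supremum only sees preimages under `φ` and `ψ`.
  refine iInf₂_le_of_le (QX.map hφ.aemeasurable) (QY.map hψ.aemeasurable) ?_
  refine iSup₂_le fun A hA => iSup₂_le fun B hB => ?_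
  refine le_iSup₂_of_le (φ ⁻¹' A) (hφ hA) (le_iSup₂_of_le (ψ ⁻¹' B) (hψ hB) ?_)
  rw [h A B hA hB, ProbabilityMeasure.toMeasure_map, ProbabilityMeasure.toMeasure_map,
    Measure.map_apply hφ hA, Measure.map_apply hψ hB]

end Sets

/-! ### Replacing the reference measures by the marginals. -/

section Empirical

variable {Ω 𝒳 𝒴 : Type*} [MeasurableSpace Ω] [MeasurableSpace 𝒳] [MeasurableSpace 𝒴]

/-- The number of coordinates of `x` that lie in `A`. -/
noncomputable def hits {m : ℕ} (A : Set 𝒳) (x : Fin m → 𝒳) : ℝ := ∑ j, A.indicator 1 (x j)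

theorem measurable_hits {m : ℕ} {A : Set 𝒳} (hA : MeasurableSet A) :
    Measurable (hits (m := m) A) :=
  Finset.measurable_sum _ fun j _ => (measurable_one.indicator hA).comp (measurable_pi_apply j)

/-- The vectors whose `i`-th coordinate lies in `A` and that have fewer than `c` coordinates
in `A`. -/
def hitAt {m : ℕ} (A : Set 𝒳) (c : ℝ) (i : Fin m) : Set (Fin m → 𝒳) :=
  {x | x i ∈ A ∧ hits A x < c}

theorem measurableSet_hitAt {m : ℕ} {A : Set 𝒳} (hA : MeasurableSet A) (c : ℝ) (i : Fin m) :
    MeasurableSet (hitAt A c i) :=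
  (measurable_pi_apply i hA).inter (measurable_hits hA measurableSet_Iio)

/-- A vector `x` lies in `hits A x` of these sets if that count is below `c`, and in none otherwise.
The bound therefore holds pointwise, and for every `Q`. -/
theorem sum_measureReal_hitAt_le {m : ℕ} {A : Set 𝒳} (hA : MeasurableSet A) {c : ℝ} (hc : 0 ≤ c)
    (Q : Measure (Fin m → 𝒳)) [IsProbabilityMeasure Q] :
    ∑ i, Q.real (hitAt A c i) ≤ c := by
  have hmeas := fun i => measurableSet_hitAt (m := m) hA c i
  have hint : ∀ i : Fin m, Integrable ((hitAt A c i).indicator (1 : (Fin m → 𝒳) → ℝ)) Q :=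
    fun i => (integrable_const 1).indicator (hmeas i)
  calc ∑ i, Q.real (hitAt A c i)
      = ∑ i, ∫ x, (hitAt A c i).indicator (1 : (Fin m → 𝒳) → ℝ) x ∂Q := by
        simp_rw [integral_indicator_one (hmeas _)]
    _ = ∫ x, ∑ i, (hitAt A c i).indicator (1 : (Fin m → 𝒳) → ℝ) x ∂Q :=
        (integral_finsetSum _ fun i _ => hint i).symm
    _ ≤ ∫ _, c ∂Q := by
        refine integral_mono (integrable_finsetSum _ fun i _ => hint i) (integrable_const c)
          fun x => ?_
        by_cases hx : hits A x < c
        · refine le_trans (le_of_eq ?_) hx.le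
          refine Finset.sum_congr rfl fun i _ => ?_
          by_cases hi : x i ∈ A <;> simp [hitAt, hi, hx]
        · refine le_trans (le_of_eq (Finset.sum_eq_zero fun i _ => ?_)) hc
          simp [hitAt, hx]
    _ = c := by simp

/-- Chebyshev: the count is a sum of `m` independent `[0, 1]`-valued variables, so its variance is
at most `m`. -/
theorem measureReal_hits_ge_le {X : Ω → 𝒳} {μ : Measure Ω} [IsProbabilityMeasure μ]
    (hX : Measurable X) {A : Set 𝒳} (hA : MeasurableSet A) {m : ℕ} (hm : 0 < m) {η : ℝ}
    (hη : 0 < η) :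
    (Measure.pi fun _ : Fin m => μ).real
      {ω | m * (μ.real (X ⁻¹' A) + η) ≤ hits A (coordwise X ω)} ≤ 1 / (m * η ^ 2) := by
  have hm' : (0 : ℝ) < m := by exact_mod_cast hm
  set Z : Ω → ℝ := (X ⁻¹' A).indicator 1 with hZ
  have hZm : Measurable Z := measurable_one.indicator (hX hA)
  have hZb : ∀ ω, Z ω ∈ Set.Icc (0 : ℝ) 1 := fun ω => by
    by_cases h : X ω ∈ A <;> simp [hZ, h]
  have hZL : MemLp Z 2 μ := MemLp.of_bound hZm.aestronglyMeasurable 1 (ae_of_all _ fun ω => by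
    rw [Real.norm_eq_abs, abs_of_nonneg (hZb ω).1]; exact (hZb ω).2)
  have hsum : (fun ω : Fin m → Ω => hits A (coordwise X ω)) =
      ∑ i, fun ω : Fin m → Ω => Z (ω i) := by
    funext ω
    simp only [hits, coordwise, Finset.sum_apply, hZ]
    rfl
  have hZLi : ∀ i : Fin m, MemLp (fun ω : Fin m → Ω => Z (ω i)) 2 (Measure.pi fun _ => μ) :=
    fun i => hZL.comp_measurePreserving (measurePreserving_eval (fun _ => μ) i)
  have hSL : MemLp (∑ i, fun ω : Fin m → Ω => Z (ω i)) 2 (Measure.pi fun _ => μ) :=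
    memLp_finsetSum' _ fun i _ => hZLi i
  have hvar : variance (∑ i, fun ω : Fin m → Ω => Z (ω i)) (Measure.pi fun _ => μ) ≤ m := by
    rw [variance_sum_pi (fun _ => hZL)]
    have hv := variance_le_sq_of_bounded (ae_of_all μ hZb) hZm.aemeasurable
    calc ∑ _i : Fin m, variance Z μ ≤ ∑ _i : Fin m, (1 : ℝ) :=
          Finset.sum_le_sum fun _ _ => hv.trans (by norm_num)
      _ = m := by simp
  have hmean : ∫ ω, (∑ i, fun ω : Fin m → Ω => Z (ω i)) ω ∂(Measure.pi fun _ => μ) =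
      m * μ.real (X ⁻¹' A) := by
    simp only [Finset.sum_apply]
    rw [integral_finsetSum _ fun i _ => (hZLi i).integrable (by norm_num)]
    have : ∀ i : Fin m, ∫ ω : Fin m → Ω, Z (ω i) ∂(Measure.pi fun _ => μ) =
        μ.real (X ⁻¹' A) := fun i => by
      rw [← integral_indicator_one (hX hA)]
      have hmp := measurePreserving_eval (fun _ : Fin m => μ) i
      have := integral_map (μ := Measure.pi fun _ : Fin m => μ) hmp.measurable.aemeasurable
        (f := Z) hZm.aestronglyMeasurable
      rw [hmp.map_eq] at this
      exact this.symm
    simp [this]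
  have hch := meas_ge_le_variance_div_sq hSL (mul_pos hm' hη)
  rw [hmean] at hch
  refine ENNReal.toReal_le_of_le_ofReal (by positivity) (le_trans (measure_mono ?_) (hch.trans ?_))
  · intro ω hω
    have h1 : m * (μ.real (X ⁻¹' A) + η) ≤ hits A (coordwise X ω) := hω
    have h2 : hits A (coordwise X ω) = (∑ i, fun ω : Fin m → Ω => Z (ω i)) ω := congrFun hsum ω
    rw [h2] at h1
    rw [Set.mem_ofPred_eq]
    refine le_trans ?_ (le_abs_self _)
    linarith
  · refine ENNReal.ofReal_le_ofReal ?_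
    rw [div_le_div_iff₀ (by positivity) (by positivity)]
    calc _ ≤ (m : ℝ) * (m * η ^ 2) := by gcongr
      _ = 1 * (m * η) ^ 2 := by ring

/-- Apply domination to the sets `hitAt` for each coordinate `i`. Their joint probability is nearly
that of `A × B`, because typical vectors have few hits, while the reference masses summed over `i`
are at most `m` times the marginal probability plus `η`. -/
theorem rpow_le_of_dominatedBy_pi {X : Ω → 𝒳} {Y : Ω → 𝒴} {μ : Measure Ω} [IsProbabilityMeasure μ]
    (hX : Measurable X) (hY : Measurable Y) {δ : ℝ≥0} {m : ℕ} (hm : 0 < m)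
    {QX : Measure (Fin m → 𝒳)} {QY : Measure (Fin m → 𝒴)}
    [IsProbabilityMeasure QX] [IsProbabilityMeasure QY]
    (h : DominatedBy (coordwise X) (coordwise Y) (Measure.pi fun _ : Fin m => μ) QX QY δ)
    {A : Set 𝒳} {B : Set 𝒴} (hA : MeasurableSet A) (hB : MeasurableSet B) {η : ℝ} (hη : 0 < η) :
    (max 0 (μ.real (X ⁻¹' A ∩ Y ⁻¹' B) - 2 * (1 / (m * η ^ 2)))) ^ (1 + (δ : ℝ)) ≤
      (μ.real (X ⁻¹' A) + η) * (μ.real (Y ⁻¹' B) + η) := by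
  have hm' : (0 : ℝ) < m := by exact_mod_cast hm
  set a := μ.real (X ⁻¹' A) with ha
  set b := μ.real (Y ⁻¹' B) with hb
  -- One Chebyshev error for each of `A` and `B`; the maximum keeps the base of the power
  -- nonnegative.
  set c := max 0 (μ.real (X ⁻¹' A ∩ Y ⁻¹' B) - 2 * (1 / (m * η ^ 2))) with hc
  set K := c ^ (1 + (δ : ℝ)) with hK
  have hc0 : 0 ≤ c := le_max_left _ _
  have hK0 : 0 ≤ K := by positivity
  have ha0 : 0 ≤ a := measureReal_nonneg
  have hb0 : 0 ≤ b := measureReal_nonneg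
  set P := Measure.pi fun _ : Fin m => μ with hP
  have hlow : ∀ i : Fin m, c ≤ P.real (coordwise X ⁻¹' hitAt A (m * (a + η)) i ∩
      coordwise Y ⁻¹' hitAt B (m * (b + η)) i) := by
    intro i
    refine max_le measureReal_nonneg ?_
    have hi : P.real (Function.eval i ⁻¹' (X ⁻¹' A ∩ Y ⁻¹' B)) = μ.real (X ⁻¹' A ∩ Y ⁻¹' B) :=
      (measurePreserving_eval (fun _ : Fin m => μ) i).measureReal_preimage
        ((hX hA).inter (hY hB)).nullMeasurableSet
    have hdA := measureReal_hits_ge_le (μ := μ) hX hA hm hη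
    have hdB := measureReal_hits_ge_le (μ := μ) hY hB hm hη
    rw [← hi]
    have hsub : (Function.eval i ⁻¹' (X ⁻¹' A ∩ Y ⁻¹' B) : Set (Fin m → Ω)) ⊆
        (coordwise X ⁻¹' hitAt A (m * (a + η)) i ∩ coordwise Y ⁻¹' hitAt B (m * (b + η)) i) ∪
        ({ω | m * (a + η) ≤ hits A (coordwise X ω)} ∪
          {ω | m * (b + η) ≤ hits B (coordwise Y ω)}) := by
      intro ω hω
      by_cases h1 : m * (a + η) ≤ hits A (coordwise X ω)
      · exact Or.inr (Or.inl h1)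
      by_cases h2 : m * (b + η) ≤ hits B (coordwise Y ω)
      · exact Or.inr (Or.inr h2)
      exact Or.inl ⟨⟨hω.1, not_le.1 h1⟩, ⟨hω.2, not_le.1 h2⟩⟩
    have h3 := (measureReal_mono (μ := P) hsub).trans ((measureReal_union_le _ _).trans
      (add_le_add le_rfl (measureReal_union_le _ _)))
    linarith
  have hdom : ∀ i : Fin m, K ≤ QX.real (hitAt A (m * (a + η)) i) *
      QY.real (hitAt B (m * (b + η)) i) := by
    intro i
    have h1 := ENNReal.toReal_mono (by finiteness) (h _ _ (measurableSet_hitAt hA (m * (a + η)) i)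
      (measurableSet_hitAt hB (m * (b + η)) i))
    rw [ENNReal.toReal_mul, ← ENNReal.toReal_rpow] at h1
    exact (Real.rpow_le_rpow hc0 (hlow i) (by positivity)).trans h1
  -- Cauchy–Schwarz over the coordinates: `(m √K)²` is at most the product of the two sums of
  -- reference masses.
  have hcs := Finset.sum_sq_le_sum_mul_sum_of_sq_le_mul (Finset.univ : Finset (Fin m))
    (r := fun _ => √K) (fun _ _ => measureReal_nonneg) (fun _ _ => measureReal_nonneg)
    (fun i _ => by rw [Real.sq_sqrt hK0]; exact hdom i)
  simp only [Finset.sum_const, Finset.card_univ, Fintype.card_fin, nsmul_eq_mul, mul_pow,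
    Real.sq_sqrt hK0] at hcs
  have hsA := sum_measureReal_hitAt_le hA (c := m * (a + η)) (by positivity) QX
  have hsB := sum_measureReal_hitAt_le hB (c := m * (b + η)) (by positivity) QY
  have h4 : (m : ℝ) ^ 2 * K ≤ m ^ 2 * ((a + η) * (b + η)) := by
    calc (m : ℝ) ^ 2 * K ≤ _ := hcs
      _ ≤ (m * (a + η)) * (m * (b + η)) := by
          gcongr
      _ = _ := by ring
  exact le_of_mul_le_mul_left h4 (by positivity)

/-- If the product vectors of all lengths are dominated by some reference measures, then the pair
itself is dominated by its own marginals. -/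
theorem dominatedBy_map_of_pi {X : Ω → 𝒳} {Y : Ω → 𝒴} {μ : Measure Ω} [IsProbabilityMeasure μ]
    (hX : Measurable X) (hY : Measurable Y) {δ : ℝ≥0}
    (h : ∀ m : ℕ, ∃ (QX : Measure (Fin m → 𝒳)) (QY : Measure (Fin m → 𝒴)),
      IsProbabilityMeasure QX ∧ IsProbabilityMeasure QY ∧
      DominatedBy (coordwise X) (coordwise Y) (Measure.pi fun _ : Fin m => μ) QX QY δ) :
    DominatedBy X Y μ (μ.map X) (μ.map Y) δ := by
  intro A B hA hB
  rw [Measure.map_apply hX hA, Measure.map_apply hY hB]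
  have hp : (0 : ℝ) < 1 + δ := by positivity
  -- The limit `m → ∞` is taken with `η` fixed; only afterwards `η ↓ 0`.
  have hη : ∀ η : ℝ, 0 < η → μ.real (X ⁻¹' A ∩ Y ⁻¹' B) ^ (1 + (δ : ℝ)) ≤
      (μ.real (X ⁻¹' A) + η) * (μ.real (Y ⁻¹' B) + η) := by
    intro η hη
    have hlim : Tendsto (fun m : ℕ => (max 0 (μ.real (X ⁻¹' A ∩ Y ⁻¹' B) -
        2 * (1 / (m * η ^ 2)))) ^ (1 + (δ : ℝ))) atTop
        (𝓝 ((max 0 (μ.real (X ⁻¹' A ∩ Y ⁻¹' B) - 2 * 0)) ^ (1 + (δ : ℝ)))) := by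
      refine Tendsto.rpow_const ?_ (Or.inr hp.le)
      refine tendsto_const_nhds.max (tendsto_const_nhds.sub (Tendsto.const_mul 2 ?_))
      refine tendsto_const_nhds.div_atTop ?_
      exact tendsto_natCast_atTop_atTop.atTop_mul_const (by positivity)
    rw [mul_zero, sub_zero, max_eq_right measureReal_nonneg] at hlim
    refine le_of_tendsto hlim ?_
    filter_upwards [eventually_gt_atTop 0] with m hm
    obtain ⟨QX, QY, _, _, hQ⟩ := h m
    exact rpow_le_of_dominatedBy_pi hX hY hm hQ hA hB hη
  have h0 : μ.real (X ⁻¹' A ∩ Y ⁻¹' B) ^ (1 + (δ : ℝ)) ≤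
      μ.real (X ⁻¹' A) * μ.real (Y ⁻¹' B) := by
    have hlim : Tendsto (fun η : ℝ => (μ.real (X ⁻¹' A) + η) * (μ.real (Y ⁻¹' B) + η)) (𝓝[>] 0)
        (𝓝 ((μ.real (X ⁻¹' A) + 0) * (μ.real (Y ⁻¹' B) + 0))) := by
      refine Tendsto.mono_left ?_ nhdsWithin_le_nhds
      exact Continuous.tendsto (by fun_prop) 0
    rw [add_zero, add_zero] at hlim
    refine ge_of_tendsto hlim ?_
    filter_upwards [self_mem_nhdsWithin] with η h using hη η h
  rw [← ENNReal.toReal_le_toReal (by finiteness) (by finiteness), ENNReal.toReal_mul,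
    ← ENNReal.toReal_rpow]
  exact h0

end Empirical

end Wringing

namespace Wringing

/-! ### The tensor power trick: from sets to functions. -/

section Power

variable {Ω 𝒳 𝒴 : Type*} [MeasurableSpace Ω] [MeasurableSpace 𝒳] [MeasurableSpace 𝒴]

theorem mul_measure_rpow_le {X : Ω → 𝒳} {μ : Measure Ω} (hX : Measurable X) {p : ℝ} (hp : 0 < p)
    {F : 𝒳 → ℝ≥0∞} (hF : Measurable F) (a : ℝ≥0∞) :
    a * μ.map X (F ⁻¹' {a}) ^ (1 / p) ≤ (∫⁻ ω, F (X ω) ^ p ∂μ) ^ (1 / p) := by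
  have hFp : Measurable fun ω => F (X ω) ^ p := (hF.comp hX).pow_const p
  have h1 : a ^ p * μ.map X (F ⁻¹' {a}) ≤ ∫⁻ ω, F (X ω) ^ p ∂μ := by
    refine le_trans (mul_le_mul_right ?_ _) (mul_meas_ge_le_lintegral hFp (a ^ p))
    rw [Measure.map_apply hX (hF (measurableSet_singleton a))]
    refine measure_mono fun ω hω => ?_
    have : F (X ω) = a := hω
    simp [this]
  have h2 := ENNReal.rpow_le_rpow h1 (one_div_pos.2 hp).le
  rwa [ENNReal.mul_rpow_of_nonneg _ _ (one_div_pos.2 hp).le, ← ENNReal.rpow_mul,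
    mul_one_div_cancel hp.ne', ENNReal.rpow_one] at h2

/-- The bilinear bound for functions with finitely many values, up to the number of values. -/
theorem DominatedBy.lintegral_mul_le {X : Ω → 𝒳} {Y : Ω → 𝒴} {μ : Measure Ω}
    (hX : Measurable X) (hY : Measurable Y) {δ : ℝ≥0}
    (h : DominatedBy X Y μ (μ.map X) (μ.map Y) δ) {F : 𝒳 → ℝ≥0∞} {G : 𝒴 → ℝ≥0∞}
    (hF : Measurable F) (hG : Measurable G) {S T : Finset ℝ≥0∞}
    (hS : ∀ x, F x ∈ S) (hT : ∀ y, G y ∈ T) :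
    ∫⁻ ω, F (X ω) * G (Y ω) ∂μ ≤ (S.card * T.card : ℝ≥0∞) *
      ((∫⁻ ω, F (X ω) ^ (1 + (δ : ℝ)) ∂μ) ^ (1 / (1 + (δ : ℝ))) *
        (∫⁻ ω, G (Y ω) ^ (1 + (δ : ℝ)) ∂μ) ^ (1 / (1 + (δ : ℝ)))) := by
  have hp : (0 : ℝ) < 1 + δ := by positivity
  set p : ℝ := 1 + δ with hpdef
  have hmeas : ∀ a b : ℝ≥0∞, MeasurableSet (X ⁻¹' (F ⁻¹' {a}) ∩ Y ⁻¹' (G ⁻¹' {b})) := fun a b =>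
    (hX (hF (measurableSet_singleton a))).inter (hY (hG (measurableSet_singleton b)))
  have hdecomp : ∀ ω, F (X ω) * G (Y ω) = ∑ a ∈ S, ∑ b ∈ T,
      (X ⁻¹' (F ⁻¹' {a}) ∩ Y ⁻¹' (G ⁻¹' {b})).indicator (fun _ => a * b) ω := by
    intro ω
    rw [Finset.sum_eq_single_of_mem (F (X ω)) (hS _), Finset.sum_eq_single_of_mem (G (Y ω)) (hT _)]
    · simp
    · intro b _ hb
      simp [hb.symm]
    · intro a _ ha
      refine Finset.sum_eq_zero fun b _ => ?_
      simp [ha.symm]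
  simp_rw [hdecomp]
  rw [lintegral_finsetSum _ fun a _ => Finset.measurable_sum _ fun b _ =>
    measurable_const.indicator (hmeas a b)]
  -- On each pair of level sets, domination and Markov's inequality bound the contribution by the
  -- full product of norms.
  have hterm : ∀ a ∈ S, ∫⁻ ω, ∑ b ∈ T,
      (X ⁻¹' (F ⁻¹' {a}) ∩ Y ⁻¹' (G ⁻¹' {b})).indicator (fun _ => a * b) ω ∂μ ≤
      T.card * ((∫⁻ ω, F (X ω) ^ p ∂μ) ^ (1 / p) * (∫⁻ ω, G (Y ω) ^ p ∂μ) ^ (1 / p)) := by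
    intro a _
    rw [lintegral_finsetSum _ fun b _ => measurable_const.indicator (hmeas a b), ← nsmul_eq_mul]
    refine Finset.sum_le_card_nsmul _ _ _ fun b _ => ?_
    rw [lintegral_indicator_const (hmeas a b)]
    have hd := h (F ⁻¹' {a}) (G ⁻¹' {b}) (hF (measurableSet_singleton a))
      (hG (measurableSet_singleton b))
    rw [← ENNReal.le_rpow_inv_iff hp, ← one_div,
      ENNReal.mul_rpow_of_nonneg _ _ (one_div_pos.2 hp).le] at hd
    calc a * b * μ (X ⁻¹' (F ⁻¹' {a}) ∩ Y ⁻¹' (G ⁻¹' {b}))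
        ≤ a * b * (μ.map X (F ⁻¹' {a}) ^ (1 / p) * μ.map Y (G ⁻¹' {b}) ^ (1 / p)) := by gcongr
      _ = (a * μ.map X (F ⁻¹' {a}) ^ (1 / p)) * (b * μ.map Y (G ⁻¹' {b}) ^ (1 / p)) := by ring
      _ ≤ _ := mul_le_mul' (mul_measure_rpow_le hX hp hF a) (mul_measure_rpow_le hY hp hG b)
  refine (Finset.sum_le_card_nsmul _ _ _ hterm).trans (le_of_eq ?_)
  rw [nsmul_eq_mul, mul_assoc]

/-- A polynomial factor disappears after taking roots. -/
theorem le_of_forall_pow_le {a b : ℝ≥0∞} {M : ℕ}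
    (h : ∀ k : ℕ, a ^ k ≤ ((k + 1) ^ M : ℕ) * b ^ k) : a ≤ b := by
  rcases eq_or_ne b ∞ with rfl | hb
  · exact le_top
  have ha : a ≠ ∞ := by
    have h1 := h 1
    rw [pow_one, pow_one] at h1
    exact ne_top_of_le_ne_top (ENNReal.mul_ne_top (ENNReal.natCast_ne_top _) hb) h1
  lift a to ℝ≥0 using ha
  lift b to ℝ≥0 using hb
  have h' : ∀ k : ℕ, (a : ℝ) ^ k ≤ ((k : ℝ) + 1) ^ M * (b : ℝ) ^ k := fun k => by
    have := h k
    exact_mod_cast this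
  by_contra hlt
  have hlt' : (b : ℝ) < a := by exact_mod_cast not_le.1 hlt
  have hb0 : (0 : ℝ) ≤ b := b.2
  have ha0 : (0 : ℝ) < a := hb0.trans_lt hlt'
  have hr0 : 0 ≤ (b : ℝ) / a := by positivity
  have hr1 : (b : ℝ) / a < 1 := (div_lt_one ha0).2 hlt'
  have hlim : Tendsto (fun k : ℕ => (((k : ℝ) + 1) ^ M) * ((b : ℝ) / a) ^ k) atTop (𝓝 0) := by
    have h1 := tendsto_pow_const_mul_const_pow_of_lt_one M hr0 hr1
    have h2 : Tendsto (fun k : ℕ => (2 : ℝ) ^ M * ((k : ℝ) ^ M * ((b : ℝ) / a) ^ k)) atTop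
        (𝓝 (2 ^ M * 0)) := h1.const_mul _
    rw [mul_zero] at h2
    -- The factor `2 ^ M` comes from `k + 1 ≤ 2 * k` for `k ≥ 1`.
    refine squeeze_zero' (Eventually.of_forall fun k => by positivity) ?_ h2
    filter_upwards [eventually_ge_atTop 1] with k hk
    have hk' : (1 : ℝ) ≤ k := by exact_mod_cast hk
    rw [← mul_assoc, ← mul_pow]
    gcongr
    linarith
  have h1 : ∀ k : ℕ, (1 : ℝ) ≤ (((k : ℝ) + 1) ^ M) * ((b : ℝ) / a) ^ k := fun k => by
    rw [div_pow, mul_div_assoc', le_div_iff₀ (by positivity), one_mul]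
    exact h' k
  have := ge_of_tendsto' hlim h1
  norm_num at this

theorem lintegral_pi_prod_eq_pow {μ : Measure Ω} [IsProbabilityMeasure μ] {u : Ω → ℝ≥0∞}
    (hu : Measurable u) (k : ℕ) :
    ∫⁻ ω, ∏ t, u (ω t) ∂(Measure.pi fun _ : Fin k => μ) = (∫⁻ ω, u ω ∂μ) ^ k := by
  have hind : iIndepFun (fun (t : Fin k) (ω : Fin k → Ω) => u (ω t)) (Measure.pi fun _ => μ) :=
    iIndepFun_pi (X := fun _ => u) fun _ => hu.aemeasurable
  rw [lintegral_prod_eq_prod_lintegral_of_indepFun Finset.univ _ hind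
    fun t => hu.comp (measurable_pi_apply t)]
  have : ∀ t : Fin k, ∫⁻ ω : Fin k → Ω, u (ω t) ∂(Measure.pi fun _ => μ) = ∫⁻ ω, u ω ∂μ :=
    fun t => (measurePreserving_eval (fun _ : Fin k => μ) t).lintegral_comp hu
  simp [this]

/-- A `k`-fold product of values in a finite set takes at most polynomially many values in `k`. -/
theorem exists_finset_forall_prod_mem {E : Type*} {R : Finset ℝ≥0∞} {f : E → ℝ≥0∞} (hf : ∀ x, f x ∈ R)
    (k : ℕ) :
    ∃ S : Finset ℝ≥0∞, S.card ≤ (k + 1) ^ R.card ∧ ∀ x : Fin k → E, ∏ t, f (x t) ∈ S := by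
  classical
  -- The product depends only on how often each value of `R` occurs, a number between `0` and `k`.
  refine ⟨Finset.univ.image fun c : R → Fin (k + 1) => ∏ v : R, (v : ℝ≥0∞) ^ (c v : ℕ), ?_, ?_⟩
  · refine Finset.card_image_le.trans ?_
    simp
  · intro x
    refine Finset.mem_image.2 ⟨fun v => ⟨(Finset.univ.filter fun t => f (x t) = v).card, ?_⟩,
      Finset.mem_univ _, ?_⟩
    · exact Nat.lt_succ_of_le ((Finset.card_le_univ _).trans (by simp))
    · rw [← Finset.prod_fiberwise_of_maps_to (s := Finset.univ) (t := R) (g := fun t => f (x t))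
        (fun t _ => hf _) fun t => f (x t)]
      refine (Finset.prod_coe_sort R fun v =>
        v ^ (Finset.univ.filter fun t => f (x t) = v).card).trans ?_
      refine Finset.prod_congr rfl fun v _ => ?_
      rw [← Finset.prod_const]
      exact Finset.prod_congr rfl fun t ht => (Finset.mem_filter.1 ht).2.symm

/-- If every product vector is dominated by its marginals, then the bilinear bound holds. -/
theorem bilinearBound_of_dominatedBy_pi {X : Ω → 𝒳} {Y : Ω → 𝒴} {μ : Measure Ω}
    [IsProbabilityMeasure μ] (hX : Measurable X) (hY : Measurable Y) {δ : ℝ≥0}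
    (h : ∀ k : ℕ, DominatedBy (coordwise X) (coordwise Y) (Measure.pi fun _ : Fin k => μ)
      ((Measure.pi fun _ : Fin k => μ).map (coordwise X))
      ((Measure.pi fun _ : Fin k => μ).map (coordwise Y)) δ) :
    BilinearBound X Y μ (1 + δ) := by
  have hp : (0 : ℝ) < 1 + δ := by positivity
  refine BilinearBound.of_simpleFunc hX hY hp.le fun f g _ _ => ?_
  -- `M` adds the exponents of the value counts of the two `k`-fold products.
  refine le_of_forall_pow_le (M := f.range.card + g.range.card) fun k => ?_
  obtain ⟨S, hSc, hS⟩ := exists_finset_forall_prod_mem f.mem_range_self k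
  obtain ⟨T, hTc, hT⟩ := exists_finset_forall_prod_mem g.mem_range_self k
  have hF : Measurable fun x : Fin k → 𝒳 => ∏ t, f (x t) :=
    Finset.measurable_prod _ fun t _ => f.measurable.comp (measurable_pi_apply t)
  have hG : Measurable fun y : Fin k → 𝒴 => ∏ t, g (y t) :=
    Finset.measurable_prod _ fun t _ => g.measurable.comp (measurable_pi_apply t)
  have hk := (h k).lintegral_mul_le (measurable_coordwise hX) (measurable_coordwise hY) hF hG hS hT
  have hfX : Measurable fun ω => f (X ω) := f.measurable.comp hX
  have hgY : Measurable fun ω => g (Y ω) := g.measurable.comp hY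
  simp only [coordwise, ← Finset.prod_mul_distrib, ← ENNReal.prod_rpow_of_nonneg hp.le] at hk
  rw [lintegral_pi_prod_eq_pow (u := fun ω => f (X ω) * g (Y ω)) (hfX.mul hgY),
    lintegral_pi_prod_eq_pow (u := fun ω => f (X ω) ^ (1 + (δ : ℝ))) (hfX.pow_const _),
    lintegral_pi_prod_eq_pow (u := fun ω => g (Y ω) ^ (1 + (δ : ℝ))) (hgY.pow_const _)] at hk
  have hpow : ∀ c : ℝ≥0∞, (c ^ k) ^ (1 / (1 + (δ : ℝ))) = (c ^ (1 / (1 + (δ : ℝ)))) ^ k := by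
    intro c
    rw [← ENNReal.rpow_natCast, ← ENNReal.rpow_natCast, ← ENNReal.rpow_mul, ← ENNReal.rpow_mul,
      mul_comm]
  rw [hpow, hpow, ← mul_pow] at hk
  refine hk.trans (mul_le_mul_left ?_ _)
  rw [pow_add]
  exact_mod_cast Nat.mul_le_mul hSc hTc

end Power

/-! ### I.i.d. vectors, blocks and the limit. -/

section Products

variable {Ω 𝒳 𝒴 : Type*} [MeasurableSpace Ω] [MeasurableSpace 𝒳] [MeasurableSpace 𝒴]

theorem measurePreserving_pi_comp_of_injective {ι κ : Type*} [Fintype ι] [Fintype κ]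
    (μ : Measure Ω) [IsProbabilityMeasure μ] {e : ι → κ} (he : Function.Injective e) :
    MeasurePreserving (fun (ω : κ → Ω) i => ω (e i)) (Measure.pi fun _ => μ)
      (Measure.pi fun _ => μ) := by
  refine ⟨measurable_pi_lambda _ fun i => measurable_pi_apply _, ?_⟩
  have hind : iIndepFun (fun (j : κ) (ω : κ → Ω) => ω j) (Measure.pi fun _ => μ) :=
    iIndepFun_pi (X := fun _ => id) fun _ => aemeasurable_id
  have h := (iIndepFun_iff_map_fun_eq_pi_map
    (fun i => (measurable_pi_apply (e i)).aemeasurable)).1 (hind.precomp he)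
  rw [h]
  congr 1
  funext i
  exact (measurePreserving_eval (fun _ : κ => μ) (e i)).map_eq

theorem measurePreserving_pi_blocks (μ : Measure Ω) [IsProbabilityMeasure μ] (m k : ℕ) :
    MeasurePreserving (fun (ω : Fin (m * k) → Ω) (i : Fin m) (j : Fin k) =>
        ω (finProdFinEquiv (i, j))) (Measure.pi fun _ => μ)
      (Measure.pi fun _ => Measure.pi fun _ => μ) := by
  have h1 := measurePreserving_pi_comp_of_injective μ
    (e := fun z : Fin m × Fin k => finProdFinEquiv z) finProdFinEquiv.injective
  have h2 : MeasurePreserving (MeasurableEquiv.curry (Fin m) (Fin k) Ω)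
      (Measure.pi fun _ => μ) (Measure.pi fun _ => Measure.pi fun _ => μ) := by
    refine ⟨MeasurableEquiv.measurable _, ?_⟩
    have := Measure.infinitePi_map_curry (fun (_ : Fin m) (_ : Fin k) => μ)
    simpa only [Measure.infinitePi_eq_pi] using this
  exact h2.comp h1

theorem measurable_blocks {m k : ℕ} :
    Measurable fun (x : Fin (m * k) → 𝒳) (i : Fin m) (j : Fin k) => x (finProdFinEquiv (i, j)) :=
  measurable_pi_lambda _ fun _ => measurable_pi_lambda _ fun _ => measurable_pi_apply _

theorem wringingDependence_coordwise_mono {X : Ω → 𝒳} {Y : Ω → 𝒴} {μ : Measure Ω}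
    [IsProbabilityMeasure μ] (hX : Measurable X) (hY : Measurable Y) {n m : ℕ} (h : n ≤ m) :
    wringingDependence (coordwise X) (coordwise Y) (Measure.pi fun _ : Fin n => μ) ≤
      wringingDependence (coordwise X) (coordwise Y) (Measure.pi fun _ : Fin m => μ) := by
  refine wringingDependence_le_of_map (φ := fun x i => x (Fin.castLE h i))
    (ψ := fun y i => y (Fin.castLE h i))
    (measurable_pi_lambda _ fun i => measurable_pi_apply _)
    (measurable_pi_lambda _ fun i => measurable_pi_apply _) fun A B hA hB => ?_
  rw [← (measurePreserving_pi_comp_of_injective μ (Fin.castLE_injective h)).measure_preimage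
    ((measurable_coordwise hX hA).inter (measurable_coordwise hY hB)).nullMeasurableSet]
  rfl

theorem wringingDependence_blocks_le {X : Ω → 𝒳} {Y : Ω → 𝒴} {μ : Measure Ω}
    [IsProbabilityMeasure μ] (hX : Measurable X) (hY : Measurable Y) (m k : ℕ) :
    wringingDependence (coordwise (coordwise X)) (coordwise (coordwise Y))
        (Measure.pi fun _ : Fin m => Measure.pi fun _ : Fin k => μ) ≤
      wringingDependence (coordwise X) (coordwise Y) (Measure.pi fun _ : Fin (m * k) => μ) := by
  refine wringingDependence_le_of_map measurable_blocks measurable_blocks fun A B hA hB => ?_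
  rw [← (measurePreserving_pi_blocks μ m k).measure_preimage
    ((measurable_coordwise (measurable_coordwise hX) hA).inter
      (measurable_coordwise (measurable_coordwise hY) hB)).nullMeasurableSet]
  rfl

theorem wringingDependence_coordwise_le_hypDependence {X : Ω → 𝒳} {Y : Ω → 𝒴} {μ : Measure Ω}
    [IsProbabilityMeasure μ] (hX : Measurable X) (hY : Measurable Y) (n : ℕ) :
    wringingDependence (coordwise X) (coordwise Y) (Measure.pi fun _ : Fin n => μ) ≤
      hypDependence X Y μ := by
  refine le_iInf fun δ => le_iInf₂ fun _ hδ => ?_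
  have hB := (bilinearBound_of_mem_ribbon hX hY hδ).pi (by positivity) hX hY n
  have := Measure.isProbabilityMeasure_map (μ := Measure.pi fun _ : Fin n => μ)
    (measurable_coordwise hX).aemeasurable
  have := Measure.isProbabilityMeasure_map (μ := Measure.pi fun _ : Fin n => μ)
    (measurable_coordwise hY).aemeasurable
  exact wringingDependence_le
    (hB.dominatedBy (measurable_coordwise hX) (measurable_coordwise hY))

theorem wringingDependence_le_hypDependence {X : Ω → 𝒳} {Y : Ω → 𝒴} {μ : Measure Ω}
    [IsProbabilityMeasure μ] (hX : Measurable X) (hY : Measurable Y) :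
    wringingDependence X Y μ ≤ hypDependence X Y μ := by
  refine le_iInf fun δ => le_iInf₂ fun _ hδ => ?_
  have := Measure.isProbabilityMeasure_map (μ := μ) hX.aemeasurable
  have := Measure.isProbabilityMeasure_map (μ := μ) hY.aemeasurable
  exact wringingDependence_le ((bilinearBound_of_mem_ribbon hX hY hδ).dominatedBy hX hY)

theorem hypDependence_le {X : Ω → 𝒳} {Y : Ω → 𝒴} {μ : Measure Ω}
    [IsProbabilityMeasure μ] (hX : Measurable X) (hY : Measurable Y) {δ : ℝ≥0}
    (h0 : 0 < δ) (h1 : δ ≤ 1) (h : BilinearBound X Y μ (1 + δ)) : hypDependence X Y μ ≤ δ :=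
  iInf_le_of_le δ (iInf₂_le_of_le h1 (mem_ribbon_of_bilinearBound hX hY h0 h1 h) le_rfl)

/-- A `δ` strictly between the two sides would dominate all powers, hence satisfy the bilinear
bound, contradicting `δ < Δ_hyp`. -/
theorem hypDependence_le_iSup_wringingDependence {X : Ω → 𝒳} {Y : Ω → 𝒴} {μ : Measure Ω}
    [IsProbabilityMeasure μ] (hX : Measurable X) (hY : Measurable Y) :
    hypDependence X Y μ ≤
      ⨆ n : ℕ, wringingDependence (coordwise X) (coordwise Y) (Measure.pi fun _ : Fin n => μ) := by
  by_contra hlt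
  obtain ⟨δ, hδ1, hδ2⟩ := ENNReal.lt_iff_exists_nnreal_btwn.1 (not_le.1 hlt)
  have hδ0 : 0 < δ := by exact_mod_cast (zero_le.trans_lt hδ1 : (0 : ℝ≥0∞) < δ)
  -- By Cauchy–Schwarz `δ = 1` is always admissible, which places the intermediate `δ` in `(0, 1]`.
  have hle1 : hypDependence X Y μ ≤ (1 : ℝ≥0) := by
    refine hypDependence_le hX hY one_pos le_rfl ?_
    have := bilinearBound_two X Y μ hX hY
    norm_num
    exact this
  have hδ1' : δ ≤ 1 := by exact_mod_cast (hδ2.le.trans hle1)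
  refine absurd (hypDependence_le hX hY hδ0 hδ1' ?_) (not_le.2 hδ2)
  refine bilinearBound_of_dominatedBy_pi hX hY fun k => ?_
  refine dominatedBy_map_of_pi (measurable_coordwise hX) (measurable_coordwise hY) fun m => ?_
  refine exists_dominatedBy_of_wringingDependence_lt ?_
  exact (wringingDependence_blocks_le hX hY m k).trans_lt ((le_iSup (fun n : ℕ =>
    wringingDependence (coordwise X) (coordwise Y) (Measure.pi fun _ : Fin n => μ))
      (m * k)).trans_lt hδ1)

/-- The wringing dependence of i.i.d. vectors is that of the coordinate vectors on a product. -/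
theorem wringingDependence_eq_coordwise {X : Ω → 𝒳} {Y : Ω → 𝒴} {μ : Measure Ω}
    [IsProbabilityMeasure μ] (hX : Measurable X) (hY : Measurable Y) {n : ℕ}
    {Ω' : Type*} [MeasurableSpace Ω'] {ν : Measure Ω'} [IsProbabilityMeasure ν]
    {Xv : Ω' → Fin n → 𝒳} {Yv : Ω' → Fin n → 𝒴} (hXv : Measurable Xv) (hYv : Measurable Yv)
    (hind : iIndepFun (fun (t : Fin n) ω => (Xv ω t, Yv ω t)) ν)
    (hid : ∀ t : Fin n, IdentDistrib (fun ω => (Xv ω t, Yv ω t)) (fun ω => (X ω, Y ω)) ν μ) :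
    wringingDependence Xv Yv ν =
      wringingDependence (coordwise X) (coordwise Y) (Measure.pi fun _ : Fin n => μ) := by
  have hpair : ∀ t : Fin n, Measurable fun ω => (Xv ω t, Yv ω t) := fun t =>
    ((measurable_pi_apply t).comp hXv).prodMk ((measurable_pi_apply t).comp hYv)
  -- The wringing dependence sees only the joint law, here the product of the laws of the pairs.
  have hlaw : ν.map (fun ω t => (Xv ω t, Yv ω t)) =
      (Measure.pi fun _ : Fin n => μ).map (fun ω t => (X (ω t), Y (ω t))) := by
    have := Measure.isProbabilityMeasure_map (μ := μ) (hX.prodMk hY).aemeasurable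
    rw [(iIndepFun_iff_map_fun_eq_pi_map fun t => (hpair t).aemeasurable).1 hind,
      Measure.pi_map_pi (μ := fun _ : Fin n => μ) (f := fun _ ω => (X ω, Y ω))
        fun _ => (hX.prodMk hY).aemeasurable]
    congr 1
    funext t
    exact (hid t).map_eq
  have hsets : ∀ (A : Set (Fin n → 𝒳)) (B : Set (Fin n → 𝒴)), MeasurableSet A → MeasurableSet B →
      ν (Xv ⁻¹' A ∩ Yv ⁻¹' B) =
        (Measure.pi fun _ : Fin n => μ) (coordwise X ⁻¹' A ∩ coordwise Y ⁻¹' B) := by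
    intro A B hA hB
    have hC : MeasurableSet {z : Fin n → 𝒳 × 𝒴 | (fun t => (z t).1) ∈ A ∧ (fun t => (z t).2) ∈ B} :=
      (measurable_pi_lambda _ (fun t => (measurable_pi_apply t).fst) hA).inter
        (measurable_pi_lambda _ (fun t => (measurable_pi_apply t).snd) hB)
    have h := congrArg (fun M => M {z : Fin n → 𝒳 × 𝒴 | (fun t => (z t).1) ∈ A ∧
      (fun t => (z t).2) ∈ B}) hlaw
    have hXY : Measurable fun (ω : Fin n → Ω) t => (X (ω t), Y (ω t)) :=
      measurable_coordwise (hX.prodMk hY)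
    rw [Measure.map_apply (measurable_pi_lambda _ hpair) hC, Measure.map_apply hXY hC] at h
    exact h
  exact le_antisymm
    (wringingDependence_le_of_map measurable_id measurable_id fun A B hA hB => hsets A B hA hB)
    (wringingDependence_le_of_map measurable_id measurable_id
      fun A B hA hB => (hsets A B hA hB).symm)

end Products

end Wringing

theorem mainTheorem10
    {Ω 𝒳 𝒴 : Type*} [MeasurableSpace Ω] [MeasurableSpace 𝒳] [MeasurableSpace 𝒴]
    (μ : Measure Ω) [IsProbabilityMeasure μ]
    (X : Ω → 𝒳) (Y : Ω → 𝒴) (hX : Measurable X) (hY : Measurable Y) :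
    Wringing.wringingDependence X Y μ ≤ Wringing.hypDependence X Y μ ∧
    -- for each `n`, random vectors `X^n`, `Y^n` (on any probability space) whose coordinate
    -- pairs are i.i.d. with the law of `(X, Y)`
    ∀ (Ω' : ℕ → Type*) [∀ n, MeasurableSpace (Ω' n)]
      (ν : ∀ n, Measure (Ω' n)) [∀ n, IsProbabilityMeasure (ν n)]
      (Xv : ∀ n, Ω' n → Fin n → 𝒳) (Yv : ∀ n, Ω' n → Fin n → 𝒴),
      (∀ n, Measurable (Xv n)) → (∀ n, Measurable (Yv n)) →
      (∀ n, iIndepFun (fun (t : Fin n) (ω : Ω' n) => (Xv n ω t, Yv n ω t)) (ν n)) →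
      (∀ n (t : Fin n), IdentDistrib (fun ω : Ω' n => (Xv n ω t, Yv n ω t))
        (fun ω : Ω => (X ω, Y ω)) (ν n) μ) →
      Monotone (fun n => Wringing.wringingDependence (Xv n) (Yv n) (ν n)) ∧
      Tendsto (fun n => Wringing.wringingDependence (Xv n) (Yv n) (ν n)) atTop
        (𝓝 (Wringing.hypDependence X Y μ)) := by
  refine ⟨Wringing.wringingDependence_le_hypDependence hX hY, ?_⟩
  intro Ω' _ ν _ Xv Yv hXv hYv hind hid
  have heq : (fun n => Wringing.wringingDependence (Xv n) (Yv n) (ν n)) = fun n : ℕ =>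
      Wringing.wringingDependence (Wringing.coordwise X) (Wringing.coordwise Y)
        (Measure.pi fun _ : Fin n => μ) :=
    funext fun n =>
      Wringing.wringingDependence_eq_coordwise hX hY (hXv n) (hYv n) (hind n) (hid n)
  have hmono : Monotone fun n : ℕ =>
      Wringing.wringingDependence (Wringing.coordwise X) (Wringing.coordwise Y)
        (Measure.pi fun _ : Fin n => μ) :=
    fun _ _ h => Wringing.wringingDependence_coordwise_mono hX hY h
  have hsup : Wringing.hypDependence X Y μ = ⨆ n : ℕ,
      Wringing.wringingDependence (Wringing.coordwise X) (Wringing.coordwise Y)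
        (Measure.pi fun _ : Fin n => μ) :=
    le_antisymm (Wringing.hypDependence_le_iSup_wringingDependence hX hY)
      (iSup_le fun n => Wringing.wringingDependence_coordwise_le_hypDependence hX hY n)
  rw [heq, hsup]
  exact ⟨hmono, tendsto_atTop_iSup hmono⟩
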